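/- **Proposition 2.** Single-sample OSO can outperform the mean-based certainty-equivalent (CE) resolving heuristic by an unbounded factor. *Setting.* In an online resource allocation problem with horizon $T$, supply nodes $\mathcal J$ and resources $\mathcal K$ with capacities $b_k$, item $t=1,\dots,T$ has rewards $r^t_j$ and consumptions $A^t_{jk}$, where the pairs $(r^t,A^t)$ are i.i.d. from a known law $\mathcal D$. Each item is irrevocably rejected or assigned to one supply node, and total consumption of each resource $k$ must not exceed $b_k$. $\mathbb E[\mathrm{OPT}]$ denotes the expected optimum of the offline integer program. In period $t$, a resolving heuristic observes item $t$, forms a forecast of items $t+1,\dots,T$, solves the integer program consisting of item $t$ and the forecast items with the residual capacities, implements the decision on item $t$, and discards the rest. Single-sample OSO forecasts by one fresh i.i.d. sample path from $\mathcal D$; CE replaces every future item by the mean item $(\mathbb E[r],\mathbb E[A])$. Both use an exact (possibly randomized) integer programming solver. The solver of OSO is equivariant: permuting the items permutes the (law of the) returned solution in the same way. The solver of CE is arbitrary if $T$ is a perfect square; for other $T$, it rejects the current item whenever some optimal solution does. *Instance.* For $d>2$ and $T>d^2$, let $|\mathcal J|=1$, let there be $d$ resources of capacity $B=\sqrt T$,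 and let all rewards equal $1$. Each item has consumption vector $e_k$ with probability $1/\sqrt T$ for each $k=1,\dots,d$, and the all-ones vector with the remaining probability $1-d/\sqrt T$. Let $\mathrm{CE}$ and $\mathrm{OSO}$ be the total rewards of the two heuristics. Then: 1. For every $d>2$ and every $M<d$ there is $T_0$ such that for all $T\ge T_0$ with $T>d^2$: $\mathbb E[\mathrm{CE}]>0$ and $\mathbb E[\mathrm{OSO}]\ge M\cdot\mathbb E[\mathrm{CE}]$. Hence the ratio is unbounded as $d$ grows. 2. The competitive ratio of CE is at most $1/d$: for every $d>2$, $\rho>1/d$ and $\alpha\in\mathbb R$ there is $T_0$ such that $\mathbb E[\mathrm{CE}]<\rho\cdot\mathbb E[\mathrm{OPT}]-\alpha$ for all $T\ge T_0$ with $T>d^2$. 3. OSO has competitive ratio $1-\varepsilon_{d,T,B}$: for all $d>2$, $T>d^2$ and $\varepsilon\in(0,0.001]$ with $\sqrt T\ge 1024\,\log\frac{2dT}{\varepsilon}\cdot\frac{\log^3(1/\varepsilon)}{\varepsilon^2}$, $\mathbb E[\mathrm{OSO}]\ge(1-\varepsilon)\,\mathbb E[\mathrm{OPT}]$. Moreover,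 there is a universal constant $C>0$ such that, for all $d>2$ and $T>d^2$, $\mathbb E[\mathrm{OSO}]\ge\bigl(1-C\sqrt{\log(dT)/B}\bigr)\,\mathbb E[\mathrm{OPT}]$ with $B=\sqrt T$. In parts 1 and 2, $T_0$ does not depend on the solvers. -/

import Mathlib

noncomputable section

namespace OnlineAllocation

/-- An item of a resource allocation problem with supply nodes `J` and resources `K`: its reward at
each supply node, and its consumption of each resource when it is assigned to a supply node. -/
structure Item (J K : Type) where
  reward : J → ℝ
  use : J → K → ℝ

/-- The reward of a decision on one item: `none` rejects it, `some j` assigns it to node `j`. -/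
def Item.gain {J K : Type} (a : Item J K) : Option J → ℝ
  | none => 0
  | some j => a.reward j

/-- The resource consumption of a decision on one item. -/
def Item.load {J K : Type} (a : Item J K) : Option J → K → ℝ
  | none => fun _ => 0
  | some j => a.use j

/-- The reward of the decisions `x` on the items `a`. -/
def totalGain {J K : Type} {n : ℕ} (a : Fin n → Item J K) (x : Fin n → Option J) : ℝ :=
  ∑ i, (a i).gain (x i)

/-- The decisions `x` on the items `a` respect the resource capacities `c`. -/
def Feasible {J K : Type} {n : ℕ} (a : Fin n → Item J K) (c : K → ℝ) (x : Fin n → Option J) :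
    Prop :=
  ∀ k, ∑ i, (a i).load (x i) k ≤ c k

/-- `x` is an optimal solution of the integer program with items `a` and capacities `c`. -/
def IsOptimal {J K : Type} {n : ℕ} (a : Fin n → Item J K) (c : K → ℝ) (x : Fin n → Option J) :
    Prop :=
  Feasible a c x ∧ ∀ y, Feasible a c y → totalGain a y ≤ totalGain a x

/-- The optimal value of the integer program with items `a` and capacities `c`. -/
def optValue {J K : Type} {n : ℕ} (a : Fin n → Item J K) (c : K → ℝ) : ℝ :=
  sSup (totalGain a '' {x | Feasible a c x})

/-- A (possibly randomized) solver of the integer programs: for all items and capacities, the law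
of the solution that it returns. -/
def Solver (J K : Type) : Type :=
  ∀ n : ℕ, (Fin n → Item J K) → (K → ℝ) → PMF (Fin n → Option J)

/-- The solver returns an optimal solution of every feasible program. -/
def Solver.IsExact {J K : Type} (s : Solver J K) : Prop :=
  ∀ (n : ℕ) (a : Fin n → Item J K) (c : K → ℝ), (∃ y, Feasible a c y) →
    ∀ x ∈ (s n a c).support, IsOptimal a c x

/-- When the items are permuted, the solution is permuted in the same way (in law). -/
def Solver.IsEquivariant {J K : Type} (s : Solver J K) : Prop :=
  ∀ (n : ℕ) (σ : Equiv.Perm (Fin n)) (a : Fin n → Item J K) (c : K → ℝ),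
    s n (a ∘ σ) c = (s n a c).map (fun x => x ∘ σ)

/-- The solver rejects the first item whenever some optimal solution does. -/
def Solver.PrefersRejection {J K : Type} (s : Solver J K) : Prop :=
  ∀ (n : ℕ) (a : Fin (n + 1) → Item J K) (c : K → ℝ), (∃ y, IsOptimal a c y ∧ y 0 = none) →
    ∀ x ∈ (s (n + 1) a c).support, x 0 = none

/-- An online resource allocation problem: in each of `horizon` periods one item arrives; the items
are `item ξ` for independent scenarios `ξ` with law `law`. -/
structure Problem (Ξ J K : Type) where
  horizon : ℕ
  law : PMF Ξ
  item : Ξ → Item J K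
  capacity : K → ℝ

/-- The expectation of `f` under a probability law on a finite type. -/
def expect {Ω : Type} [Fintype Ω] (p : PMF Ω) (f : Ω → ℝ) : ℝ :=
  ∑ ω, (p ω).toReal * f ω

/-- The law of `n` independent draws from `p`. -/
def iid {Ξ : Type} (p : PMF Ξ) : (n : ℕ) → PMF (Fin n → Ξ)
  | 0 => PMF.pure Fin.elim0
  | n + 1 => p.bind fun ξ => (iid p n).map fun ζ => Fin.cons ξ ζ

/-- The item whose rewards and consumptions are the expected ones. -/
def Problem.meanItem {Ξ J K : Type} [Fintype Ξ] (P : Problem Ξ J K) : Item J K where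
  reward j := expect P.law fun ξ => (P.item ξ).reward j
  use j k := expect P.law fun ξ => (P.item ξ).use j k

/-- The law of the arrivals and decisions of a resolving heuristic over the last `n` periods, from
the residual capacities `c`. In each period, the heuristic observes the current scenario `ξ`, draws
a forecast `f` of the items of the remaining periods, solves the program made of the current item
and the forecast items, implements the decision on the current item, and discards the rest. -/
def Problem.resolve {Ξ J K : Type} (P : Problem Ξ J K)
    (forecast : (n : ℕ) → PMF (Fin n → Item J K)) (s : Solver J K) :
    (n : ℕ) → (K → ℝ) → PMF (Fin n → Ξ × Option J)
  | 0, _ => PMF.pure Fin.elim0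
  | n + 1, c =>
    P.law.bind fun ξ =>
      (forecast n).bind fun f =>
        (s (n + 1) (Fin.cons (P.item ξ) f) c).bind fun x =>
          (P.resolve forecast s n fun k => c k - (P.item ξ).load (x 0) k).map fun ω =>
            Fin.cons (ξ, x 0) ω

/-- Expected total reward of the resolving heuristic over the whole horizon. -/
def Problem.resolveValue {Ξ J K : Type} [Fintype Ξ] [Fintype J] (P : Problem Ξ J K)
    (forecast : (n : ℕ) → PMF (Fin n → Item J K)) (s : Solver J K) : ℝ :=
  expect (P.resolve forecast s P.horizon P.capacity) fun ω =>
    ∑ t, (P.item (ω t).1).gain (ω t).2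

/-- Expected total reward of single-sample OSO: in each period, the forecast is one fresh sample
path of the remaining periods. -/
def Problem.osoValue {Ξ J K : Type} [Fintype Ξ] [Fintype J] (P : Problem Ξ J K)
    (s : Solver J K) : ℝ :=
  P.resolveValue (fun n => (iid P.law n).map fun ζ i => P.item (ζ i)) s

/-- Expected total reward of the mean-based certainty-equivalent resolving heuristic: all future
parameters are replaced by their expectations. -/
def Problem.ceValue {Ξ J K : Type} [Fintype Ξ] [Fintype J] (P : Problem Ξ J K)
    (s : Solver J K) : ℝ :=
  P.resolveValue (fun _ => PMF.pure fun _ => P.meanItem) s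

/-- Expected hindsight optimum. -/
def Problem.optExpected {Ξ J K : Type} [Fintype Ξ] (P : Problem Ξ J K) : ℝ :=
  expect (iid P.law P.horizon) fun ξ => optValue (fun t => P.item (ξ t)) P.capacity

/-- The scenario law: `some k` with probability `1 / √T` for each `k`, and `none` otherwise. -/
def scenarioLaw (d T : ℕ) (h : d ^ 2 < T) : PMF (Option (Fin d)) :=
  PMF.ofFintype
    (fun o => match o with
      | none => ENNReal.ofReal (1 - d / √(T : ℝ))
      | some _ => ENNReal.ofReal (1 / √(T : ℝ)))
    (by
      have hT : (0 : ℝ) < √(T : ℝ) := Real.sqrt_pos.2 (by exact_mod_cast (Nat.zero_le _).trans_lt h)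
      have hd : (d : ℝ) / √(T : ℝ) ≤ 1 := by
        rw [div_le_one hT]
        exact Real.le_sqrt_of_sq_le (by exact_mod_cast h.le)
      rw [Fintype.sum_option, Finset.sum_const, Finset.card_univ, Fintype.card_fin, nsmul_eq_mul,
        ← ENNReal.ofReal_natCast, ← ENNReal.ofReal_mul (by positivity),
        ← ENNReal.ofReal_add (by linarith) (by positivity), ← ENNReal.ofReal_one]
      congr 1
      ring)

/-- The multidimensional knapsack with `T` periods and `d` resources of capacity `√T`. All rewards
are `1`; an item consumes one unit of resource `k` only, with probability `1 / √T` for each `k`,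
and one unit of every resource otherwise. -/
def knapsack (d T : ℕ) (h : d ^ 2 < T) : Problem (Option (Fin d)) Unit (Fin d) where
  horizon := T
  law := scenarioLaw d T h
  item o :=
    { reward := fun _ => 1
      use := fun _ k => match o with
        | none => 1
        | some l => if k = l then 1 else 0 }
  capacity _ := √(T : ℝ)

end OnlineAllocation

end

/-! Both heuristics are compared with `d * √T`. This bounds the optimum, since an accepted item
takes at least one unit of capacity in total, and it is nearly attained by accepting only
single-resource items, about `√T` of which arrive for each resource.

CE cannot see this structure. A mean item earns `1` and uses `meanUse d T < 1` of every resource, so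
it looks cheaper than any real item. As long as enough periods remain, CE saves its capacity for
mean items. If `T` is a square, the capacity is a whole number `√T` of mean items plus an excess of
`d - 1` units per resource, and only that excess is spent early; if the solver prefers rejection,
nothing is. The last `√T` or so periods earn at most one each, hence CE collects at most `√T + d *
(d - 1)` (`knapsack_ceValue_le`).

For OSO, the current item and the sample path are exchangeable, so by equivariance the first
decision is an average one (`expect_solver_first`). With `N` items to go and capacities `c k`, its
expected load on `k` is at most `c k / N`, and its expected gain is at least `1 / N` of the expected
value of the single-resource policy. With `p = 1 / √T`, that policy loses about `√(N * p) + (N * p -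
c k)⁺` on resource `k` relative to `N * p`. The load bound keeps the deficit `(N * p - c k)⁺` small:
after one step its mean shrinks by the factor `(N - 1) / N`, with variance at most `p`. The
quadratic potential `shortfall` turns this into a backward induction (`shortfall_step`,
`le_knapsack_valueFrom_oso`). The deficit starts at zero, and the losses `(√(m * p) + 1) / m` add up
to `O(T ^ (1 / 4) + log T)` per resource (`le_osoRate`). All ratios follow. -/

namespace OnlineAllocation

/-! ### Finite expectations and moments of i.i.d. samples -/

section Expect

variable {Ω Ω' Ξ : Type} [Fintype Ω] [Fintype Ω'] [Fintype Ξ]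

theorem sum_toReal_eq_one (p : PMF Ω) : ∑ ω, (p ω).toReal = 1 := by
  rw [← ENNReal.toReal_sum fun ω _ => p.apply_ne_top ω, ← tsum_fintype (L := .unconditional _),
    p.tsum_coe, ENNReal.toReal_one]

theorem expect_const (p : PMF Ω) (a : ℝ) : expect p (fun _ => a) = a := by
  rw [expect, ← Finset.sum_mul, sum_toReal_eq_one, one_mul]

theorem expect_add (p : PMF Ω) (f g : Ω → ℝ) :
    expect p (fun ω => f ω + g ω) = expect p f + expect p g := by
  simp only [expect, mul_add, Finset.sum_add_distrib]

theorem expect_sub (p : PMF Ω) (f g : Ω → ℝ) :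
    expect p (fun ω => f ω - g ω) = expect p f - expect p g := by
  simp only [expect, mul_sub, Finset.sum_sub_distrib]

theorem expect_const_mul (p : PMF Ω) (a : ℝ) (f : Ω → ℝ) :
    expect p (fun ω => a * f ω) = a * expect p f := by
  simp only [expect, Finset.mul_sum]
  exact Finset.sum_congr rfl fun ω _ => by ring

theorem expect_sum {ι : Type} (p : PMF Ω) (S : Finset ι) (f : ι → Ω → ℝ) :
    expect p (fun ω => ∑ i ∈ S, f i ω) = ∑ i ∈ S, expect p (f i) := by
  simp only [expect, Finset.mul_sum]
  exact Finset.sum_comm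

theorem expect_mono {p : PMF Ω} {f g : Ω → ℝ} (h : ∀ ω ∈ p.support, f ω ≤ g ω) :
    expect p f ≤ expect p g := by
  refine Finset.sum_le_sum fun ω _ => ?_
  by_cases hω : ω ∈ p.support
  · exact mul_le_mul_of_nonneg_left (h ω hω) ENNReal.toReal_nonneg
  · rw [(p.apply_eq_zero_iff ω).2 hω, ENNReal.toReal_zero, zero_mul, zero_mul]

theorem expect_le {p : PMF Ω} {f : Ω → ℝ} {a : ℝ} (h : ∀ ω ∈ p.support, f ω ≤ a) :
    expect p f ≤ a :=
  (expect_mono h).trans_eq (expect_const p a)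

theorem le_expect {p : PMF Ω} {f : Ω → ℝ} {a : ℝ} (h : ∀ ω ∈ p.support, a ≤ f ω) :
    a ≤ expect p f :=
  (expect_const p a).symm.trans_le (expect_mono h)

theorem expect_pure (ω : Ω) (f : Ω → ℝ) : expect (PMF.pure ω) f = f ω := by
  classical
  rw [expect, Finset.sum_eq_single ω]
  · simp
  · intro b _ hb
    simp [PMF.pure_apply, hb]
  · simp

theorem expect_bind (p : PMF Ω) (k : Ω → PMF Ω') (f : Ω' → ℝ) :
    expect (p.bind k) f = expect p fun ω => expect (k ω) f := by
  have h : ∀ b, ((p.bind k) b).toReal = ∑ ω, (p ω).toReal * (k ω b).toReal := by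
    intro b
    rw [PMF.bind_apply, tsum_fintype, ENNReal.toReal_sum fun ω _ =>
      ENNReal.mul_ne_top (p.apply_ne_top ω) ((k ω).apply_ne_top b)]
    simp only [ENNReal.toReal_mul]
  simp only [expect, h, Finset.sum_mul, Finset.mul_sum]
  rw [Finset.sum_comm]
  exact Finset.sum_congr rfl fun ω _ => Finset.sum_congr rfl fun b _ => by ring

theorem expect_map (p : PMF Ω) (k : Ω → Ω') (f : Ω' → ℝ) :
    expect (p.map k) f = expect p fun ω => f (k ω) := by
  rw [← PMF.bind_pure_comp, expect_bind]
  simp only [Function.comp, expect_pure]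

theorem expect_iid_succ (p : PMF Ξ) (n : ℕ) (f : (Fin (n + 1) → Ξ) → ℝ) :
    expect (iid p (n + 1)) f = expect p fun ξ => expect (iid p n) fun ζ => f (Fin.cons ξ ζ) := by
  rw [iid, expect_bind]
  simp only [expect_map]

theorem iid_apply (p : PMF Ξ) (n : ℕ) (ζ : Fin n → Ξ) : iid p n ζ = ∏ i, p (ζ i) := by
  classical
  induction n with
  | zero =>
    simp [iid, PMF.pure_apply, Subsingleton.elim ζ Fin.elim0]
  | succ n ih =>
    rw [iid, PMF.bind_apply, tsum_fintype, Finset.sum_eq_single (ζ 0), Fin.prod_univ_succ]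
    · congr 1
      rw [PMF.map_apply, tsum_fintype, Finset.sum_eq_single (Fin.tail ζ)]
      · rw [Fin.cons_self_tail, if_pos rfl, ih]
        rfl
      · intro b _ hb
        rw [if_neg]
        rintro h
        exact hb (by rw [h, Fin.tail_cons])
      · simp
    · intro b _ hb
      rw [PMF.map_apply, tsum_fintype, Finset.sum_eq_zero, mul_zero]
      intro c _
      rw [if_neg]
      rintro h
      exact hb (by rw [h, Fin.cons_zero])
    · simp

theorem expect_iid_perm (p : PMF Ξ) {n : ℕ} (σ : Equiv.Perm (Fin n)) (f : (Fin n → Ξ) → ℝ) :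
    expect (iid p n) (fun ζ => f (ζ ∘ σ)) = expect (iid p n) f := by
  refine Fintype.sum_equiv (σ.symm.arrowCongr (Equiv.refl Ξ)) _ _ fun ζ => ?_
  have h : (σ.symm.arrowCongr (Equiv.refl Ξ)) ζ = ζ ∘ σ := by
    ext i
    simp [Equiv.arrowCongr]
  rw [h, iid_apply, iid_apply]
  simp only [Function.comp]
  rw [Equiv.prod_comp σ fun i => p (ζ i)]

theorem expect_iid_sum (p : PMF Ξ) (n : ℕ) (g : Ξ → ℝ) :
    expect (iid p n) (fun ζ => ∑ i, g (ζ i)) = n * expect p g := by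
  induction n with
  | zero => simp [expect_const]
  | succ n ih =>
    rw [expect_iid_succ]
    simp only [Fin.sum_univ_succ, Fin.cons_zero, Fin.cons_succ, expect_add, expect_const, ih]
    push_cast
    ring

theorem expect_iid_sum_sq (p : PMF Ξ) (n : ℕ) (g : Ξ → ℝ) (hg : expect p g = 0) :
    expect (iid p n) (fun ζ => (∑ i, g (ζ i)) ^ 2) = n * expect p fun ξ => g ξ ^ 2 := by
  induction n with
  | zero => simp [expect_const]
  | succ n ih =>
    rw [expect_iid_succ]
    simp only [Fin.sum_univ_succ, Fin.cons_zero, Fin.cons_succ, add_sq, expect_add, expect_const,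
      ih, expect_const_mul, expect_iid_sum, hg, mul_zero]
    push_cast
    ring

end Expect

/-! ### Exchangeability and one-step recursions for resolving heuristics -/

section Solvers

variable {Ξ J K : Type}

/-- For an equivariant solver applied to i.i.d. items, the decision on the first item represents
the decisions on all items. -/
theorem expect_solver_first [Fintype Ξ] [Fintype J] {s : Solver J K} (hs : s.IsEquivariant) (p : PMF Ξ)
    (item : Ξ → Item J K) (n : ℕ) (c : K → ℝ) (g : Item J K → Option J → ℝ) :
    (n + 1 : ℝ) * expect (iid p (n + 1)) (fun ζ =>
        expect (s (n + 1) (fun i => item (ζ i)) c) fun x => g (item (ζ 0)) (x 0)) =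
      expect (iid p (n + 1)) fun ζ =>
        expect (s (n + 1) (fun i => item (ζ i)) c) fun x => ∑ i, g (item (ζ i)) (x i) := by
  simp only [expect_sum]
  have h : ∀ i : Fin (n + 1), expect (iid p (n + 1)) (fun ζ =>
      expect (s (n + 1) (fun i => item (ζ i)) c) fun x => g (item (ζ i)) (x i)) =
      expect (iid p (n + 1)) (fun ζ =>
        expect (s (n + 1) (fun i => item (ζ i)) c) fun x => g (item (ζ 0)) (x 0)) := by
    intro i
    -- Swapping items `0` and `i` preserves the law of the sample, and equivariance carries the
    -- decision along.
    rw [← expect_iid_perm p (Equiv.swap 0 i) fun ζ =>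
      expect (s (n + 1) (fun i => item (ζ i)) c) fun x => g (item (ζ 0)) (x 0)]
    refine congrArg _ (funext fun ζ => ?_)
    have := hs (n + 1) (Equiv.swap 0 i) (fun i => item (ζ i)) c
    rw [show (fun j => item ((ζ ∘ Equiv.swap 0 i) j)) = (fun i => item (ζ i)) ∘ Equiv.swap 0 i from
      rfl, this, expect_map]
    simp
  rw [Finset.sum_congr rfl fun i _ => h i]
  simp

/-- The expected reward of a resolving heuristic over the last `n` periods. -/
noncomputable def Problem.valueFrom [Fintype Ξ] [Fintype J] (P : Problem Ξ J K) (forecast : (n : ℕ) → PMF (Fin n → Item J K))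
    (s : Solver J K) (n : ℕ) (c : K → ℝ) : ℝ :=
  expect (P.resolve forecast s n c) fun ω => ∑ t, (P.item (ω t).1).gain (ω t).2

theorem Problem.valueFrom_zero [Fintype Ξ] [Fintype J] (P : Problem Ξ J K)
    (forecast : (n : ℕ) → PMF (Fin n → Item J K)) (s : Solver J K) (c : K → ℝ) :
    P.valueFrom forecast s 0 c = 0 := by
  simp [valueFrom, expect_const]

theorem Problem.valueFrom_oso_succ [Fintype Ξ] [Fintype J] (P : Problem Ξ J K) (s : Solver J K) (n : ℕ) (c : K → ℝ) :
    P.valueFrom (fun n => (iid P.law n).map fun ζ i => P.item (ζ i)) s (n + 1) c =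
      expect (iid P.law (n + 1)) fun ζ => expect (s (n + 1) (fun i => P.item (ζ i)) c) fun x =>
        (P.item (ζ 0)).gain (x 0) +
          P.valueFrom (fun n => (iid P.law n).map fun ζ i => P.item (ζ i)) s n
            fun k => c k - (P.item (ζ 0)).load (x 0) k := by
  have h : ∀ (ξ : Ξ) (ζ : Fin n → Ξ),
      (Fin.cons (P.item ξ) fun i => P.item (ζ i) : Fin (n + 1) → Item J K) =
        fun i => P.item ((Fin.cons ξ ζ : Fin (n + 1) → Ξ) i) := by
    intro ξ ζ
    funext i
    refine Fin.cases ?_ (fun j => ?_) i <;> simp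
  rw [expect_iid_succ, valueFrom, resolve]
  simp only [PMF.bind_map, Function.comp, expect_bind, expect_map, h, Fin.sum_univ_succ,
    Fin.cons_zero, Fin.cons_succ, expect_add, expect_const, valueFrom]

theorem Problem.valueFrom_ce_succ [Fintype Ξ] [Fintype J] (P : Problem Ξ J K) (s : Solver J K) (n : ℕ) (c : K → ℝ) :
    P.valueFrom (fun _ => PMF.pure fun _ => P.meanItem) s (n + 1) c =
      expect P.law fun ξ => expect (s (n + 1) (Fin.cons (P.item ξ) fun _ => P.meanItem) c) fun x =>
        (P.item ξ).gain (x 0) + P.valueFrom (fun _ => PMF.pure fun _ => P.meanItem) s n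
          fun k => c k - (P.item ξ).load (x 0) k := by
  rw [valueFrom, resolve]
  simp only [PMF.pure_bind, expect_bind, expect_map, Fin.sum_univ_succ,
    Fin.cons_zero, Fin.cons_succ, expect_add, expect_const, valueFrom]

theorem IsOptimal.optValue_eq {n : ℕ} {a : Fin n → Item J K} {c : K → ℝ} {x : Fin n → Option J}
    (h : IsOptimal a c x) : optValue a c = totalGain a x := by
  refine IsGreatest.csSup_eq ⟨⟨x, h.1, rfl⟩, ?_⟩
  rintro _ ⟨y, hy, rfl⟩
  exact h.2 y hy

theorem exists_isOptimal [Fintype J] {n : ℕ} {a : Fin n → Item J K} {c : K → ℝ} (h : ∃ y, Feasible a c y) :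
    ∃ x, IsOptimal a c x := by
  obtain ⟨x, hx, hmax⟩ := Set.exists_max_image {x | Feasible a c x} (totalGain a)
    (Set.toFinite _) h
  exact ⟨x, hx, hmax⟩

theorem feasible_none {n : ℕ} (a : Fin n → Item J K) {c : K → ℝ} (hc : ∀ k, 0 ≤ c k) :
    Feasible a c fun _ => none := by
  intro k
  simpa [Item.load] using hc k

end Solvers

end OnlineAllocation
namespace OnlineAllocation

/-! ### The instance: feasible policies and the hindsight optimum -/

section Knapsack

variable {d T : ℕ} {hT : d ^ 2 < T}

theorem sqrt_horizon_pos (hT : d ^ 2 < T) : 0 < √(T : ℝ) :=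
  Real.sqrt_pos.2 (by exact_mod_cast (Nat.zero_le _).trans_lt hT)

theorem lt_sqrt_horizon (hT : d ^ 2 < T) : (d : ℝ) < √(T : ℝ) :=
  Real.lt_sqrt_of_sq_lt (by exact_mod_cast hT)

theorem expect_scenarioLaw (f : Option (Fin d) → ℝ) :
    expect (scenarioLaw d T hT) f =
      (1 - d / √(T : ℝ)) * f none + ∑ k, 1 / √(T : ℝ) * f (some k) := by
  have h : (d : ℝ) / √(T : ℝ) ≤ 1 :=
    (div_le_one (sqrt_horizon_pos hT)).2 (lt_sqrt_horizon hT).le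
  rw [expect, Fintype.sum_option]
  simp only [scenarioLaw, PMF.ofFintype_apply]
  rw [ENNReal.toReal_ofReal (by linarith), ENNReal.toReal_ofReal (by positivity)]

theorem knapsack_gain_le_one (o : Option (Fin d)) (x : Option Unit) :
    ((knapsack d T hT).item o).gain x ≤ 1 := by
  cases x <;> simp [Item.gain, knapsack]

theorem knapsack_gain_nonneg (o : Option (Fin d)) (x : Option Unit) :
    0 ≤ ((knapsack d T hT).item o).gain x := by
  cases x <;> simp [Item.gain, knapsack]

theorem knapsack_load_eq (o : Option (Fin d)) (x : Option Unit) (k : Fin d) :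
    ((knapsack d T hT).item o).load x k = 0 ∨ ((knapsack d T hT).item o).load x k = 1 := by
  rcases x with _ | x
  · exact Or.inl rfl
  · rcases o with _ | l
    · exact Or.inr rfl
    · by_cases h : k = l <;> simp [Item.load, knapsack, h]

theorem knapsack_load_nonneg (o : Option (Fin d)) (x : Option Unit) (k : Fin d) :
    0 ≤ ((knapsack d T hT).item o).load x k := by
  rcases knapsack_load_eq (hT := hT) o x k with h | h <;> rw [h]
  exact zero_le_one

theorem knapsack_gain_le_load (hd : 0 < d) (o : Option (Fin d)) (x : Option Unit) :
    ((knapsack d T hT).item o).gain x ≤ ∑ k, ((knapsack d T hT).item o).load x k := by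
  rcases x with _ | x
  · simp [Item.gain, Item.load]
  · rcases o with _ | l
    · simp only [Item.gain, Item.load, knapsack]
      simpa using Nat.one_le_iff_ne_zero.2 hd.ne'
    · simp [Item.gain, Item.load, knapsack]

theorem knapsack_totalGain_le (hd : 0 < d) {n : ℕ} {ζ : Fin n → Option (Fin d)} {c : Fin d → ℝ}
    {x : Fin n → Option Unit} (hx : Feasible (fun i => (knapsack d T hT).item (ζ i)) c x) :
    totalGain (fun i => (knapsack d T hT).item (ζ i)) x ≤ ∑ k, c k :=
  calc totalGain (fun i => (knapsack d T hT).item (ζ i)) x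
      ≤ ∑ i, ∑ k, ((knapsack d T hT).item (ζ i)).load (x i) k :=
        Finset.sum_le_sum fun i _ => knapsack_gain_le_load hd (ζ i) (x i)
    _ = ∑ k, ∑ i, ((knapsack d T hT).item (ζ i)).load (x i) k := Finset.sum_comm
    _ ≤ ∑ k, c k := Finset.sum_le_sum fun k _ => hx k

/-- The number of items that consume only resource `k`. -/
noncomputable def count {n : ℕ} (ζ : Fin n → Option (Fin d)) (k : Fin d) : ℝ :=
  ∑ i, if ζ i = some k then 1 else 0

/-- Single-resource items of different types do not compete, so each resource can be filled
separately, ignoring the all-ones items. -/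
theorem exists_feasible_totalGain {n : ℕ} (ζ : Fin n → Option (Fin d)) {c : Fin d → ℝ}
    (hc : ∀ k, 0 ≤ c k) :
    ∃ y, Feasible (fun i => (knapsack d T hT).item (ζ i)) c y ∧
      totalGain (fun i => (knapsack d T hT).item (ζ i)) y = ∑ k, min (count ζ k) ⌊c k⌋₊ := by
  have hS : ∀ k, ∃ S ⊆ Finset.univ.filter (fun i => ζ i = some k),
      S.card = min (Finset.univ.filter fun i => ζ i = some k).card ⌊c k⌋₊ := fun k =>
    Finset.exists_subset_card_eq (min_le_left _ _)
  choose S hS hcard using hS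
  have hmem : ∀ {k i}, i ∈ S k → ζ i = some k := fun h => (Finset.mem_filter.1 (hS _ h)).2
  have hload : ∀ i k, ((knapsack d T hT).item (ζ i)).load
      (if ∃ l, i ∈ S l then some () else none) k = if i ∈ S k then 1 else 0 := by
    intro i k
    split_ifs with h h' h'
    · simp [Item.load, knapsack, hmem h']
    · obtain ⟨l, hl⟩ := h
      have hkl : k ≠ l := fun e => h' (e ▸ hl)
      simp [Item.load, knapsack, hmem hl, hkl]
    · exact absurd ⟨k, h'⟩ h
    · rfl
  have hgain : ∀ i, ((knapsack d T hT).item (ζ i)).gain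
      (if ∃ l, i ∈ S l then some () else none) = ∑ k, if i ∈ S k then 1 else 0 := by
    intro i
    split_ifs with h
    · obtain ⟨l, hl⟩ := h
      rw [Finset.sum_eq_single l, if_pos hl]
      · rfl
      · intro k _ hk
        rw [if_neg]
        intro h'
        exact hk (Option.some.inj ((hmem h').symm.trans (hmem hl)))
      · simp
    · push Not at h
      simp [h, Item.gain]
  refine ⟨fun i => if ∃ l, i ∈ S l then some () else none, fun k => ?_, ?_⟩
  · simp only [hload]
    rw [Finset.sum_boole, Finset.filter_mem_eq_inter, Finset.univ_inter, hcard]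
    exact (Nat.cast_le.2 (min_le_right _ _)).trans (Nat.floor_le (hc k))
  · simp only [totalGain, hgain]
    rw [Finset.sum_comm]
    refine Finset.sum_congr rfl fun k _ => ?_
    rw [Finset.sum_boole, Finset.filter_mem_eq_inter, Finset.univ_inter, hcard, Nat.cast_min,
      count, Finset.sum_boole]

/-- A second-moment argument: the count has mean `n * p` and variance at most `n * p`, so
fluctuations cost `√(n * p)`; the final `1` pays for the floor. -/
theorem le_expect_min_count {n : ℕ} (hn : 0 < n) (k : Fin d) (c : ℝ) :
    n * (1 / √(T : ℝ)) - √(n * (1 / √(T : ℝ))) - max (n * (1 / √(T : ℝ)) - c) 0 - 1 ≤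
      expect (iid (scenarioLaw d T hT) n) fun ζ => min (count ζ k) ⌊c⌋₊ := by
  set p : ℝ := 1 / √(T : ℝ) with hp
  have hp0 : 0 < p := one_div_pos.2 (sqrt_horizon_pos hT)
  have hnp : 0 < n * p := by positivity
  have hs : 0 < √(n * p) := Real.sqrt_pos.2 hnp
  have hss : √(n * p) ^ 2 = n * p := Real.sq_sqrt hnp.le
  set g : Option (Fin d) → ℝ := fun o => (if o = some k then 1 else 0) - p with hg
  have hind : expect (scenarioLaw d T hT) (fun o => if o = some k then (1 : ℝ) else 0) = p := by
    rw [expect_scenarioLaw]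
    simp [hp]
  have hg0 : expect (scenarioLaw d T hT) g = 0 := by
    rw [hg, expect_sub, hind, expect_const, sub_self]
  have hg2 : expect (scenarioLaw d T hT) (fun o => g o ^ 2) ≤ p := by
    have : ∀ o, g o ^ 2 = (1 - 2 * p) * (if o = some k then 1 else 0) + p ^ 2 := by
      intro o
      simp only [hg]
      split_ifs <;> ring
    simp only [this, expect_add, expect_const_mul, hind, expect_const]
    nlinarith
  have hcount : ∀ ζ : Fin n → Option (Fin d), count ζ k = ∑ i, g (ζ i) + n * p := by
    intro ζ
    simp [count, hg]
  have hfloor : c - 1 ≤ (⌊c⌋₊ : ℝ) := by linarith [Nat.lt_floor_add_one c]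
  -- The minimum is bounded below by a quadratic in the centred sum `W`, through `W ≤ W ^ 2 / (2 *
  -- s) + s / 2` with `s = √(n * p)`; only two moments are then needed.
  have hmin : ∀ ζ : Fin n → Option (Fin d), n * p - √(n * p) / 2 - max (n * p - c) 0 - 1 +
      ∑ i, g (ζ i) - 1 / (2 * √(n * p)) * (∑ i, g (ζ i)) ^ 2 ≤ min (count ζ k) ⌊c⌋₊ := by
    intro ζ
    rw [hcount]
    generalize ∑ i, g (ζ i) = W
    have h1 : W ≤ 1 / (2 * √(n * p)) * W ^ 2 + √(n * p) / 2 := by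
      have : 1 / (2 * √(n * p)) * W ^ 2 + √(n * p) / 2 - W =
          (W - √(n * p)) ^ 2 / (2 * √(n * p)) := by
        field_simp
        ring
      have : 0 ≤ (W - √(n * p)) ^ 2 / (2 * √(n * p)) := by positivity
      linarith
    have h2 : 0 ≤ 1 / (2 * √(n * p)) * W ^ 2 := by positivity
    have h3 := le_max_left (n * p - c) 0
    have h4 := le_max_right (n * p - c) 0
    refine le_min ?_ ?_ <;> linarith
  calc n * p - √(n * p) - max (n * p - c) 0 - 1
      ≤ n * p - √(n * p) / 2 - max (n * p - c) 0 - 1 + n * 0 -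
          1 / (2 * √(n * p)) * (n * expect (scenarioLaw d T hT) fun o => g o ^ 2) := by
        have : 1 / (2 * √(n * p)) * (n * expect (scenarioLaw d T hT) fun o => g o ^ 2) ≤
            1 / (2 * √(n * p)) * (n * p) := by gcongr
        have h2 : 1 / (2 * √(n * p)) * (n * p) = √(n * p) / 2 := by
          nth_rewrite 2 [← hss]
          field_simp
        linarith
    _ = _ := by
        simp only [expect_add, expect_sub, expect_const, expect_const_mul]
        rw [expect_iid_sum_sq _ _ _ hg0, expect_iid_sum, hg0]
    _ ≤ _ := expect_mono fun ζ _ => hmin ζ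

theorem le_expect_sum_min_count {n : ℕ} (hn : 0 < n) (c : Fin d → ℝ) :
    ∑ k, (n * (1 / √(T : ℝ)) - √(n * (1 / √(T : ℝ))) - max (n * (1 / √(T : ℝ)) - c k) 0 - 1) ≤
      expect (iid (scenarioLaw d T hT) n) fun ζ => ∑ k, min (count ζ k) ⌊c k⌋₊ := by
  rw [expect_sum]
  exact Finset.sum_le_sum fun k _ => le_expect_min_count hn k (c k)

theorem knapsack_optExpected_nonneg : 0 ≤ (knapsack d T hT).optExpected := by
  refine le_expect fun ζ _ => Real.sSup_nonneg ?_
  rintro _ ⟨x, -, rfl⟩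
  exact Finset.sum_nonneg fun i _ => knapsack_gain_nonneg _ _

theorem knapsack_optExpected_le (hd : 0 < d) :
    (knapsack d T hT).optExpected ≤ d * √(T : ℝ) := by
  refine expect_le fun ζ _ => ?_
  obtain ⟨x, hx⟩ := exists_isOptimal (a := fun t => (knapsack d T hT).item (ζ t))
    ⟨_, feasible_none _ (c := (knapsack d T hT).capacity) fun _ => Real.sqrt_nonneg _⟩
  rw [hx.optValue_eq]
  refine (knapsack_totalGain_le hd hx.1).trans_eq ?_
  simp [knapsack]

theorem le_knapsack_optExpected :
    d * (√(T : ℝ) - √√(T : ℝ) - 1) ≤ (knapsack d T hT).optExpected := by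
  have hT0 : 0 < T := (Nat.zero_le _).trans_lt hT
  have hTp : T * (1 / √(T : ℝ)) = √(T : ℝ) := by
    rw [mul_one_div, Real.div_sqrt]
  have h := le_expect_sum_min_count (hT := hT) hT0 fun _ => √(T : ℝ)
  simp only [hTp, sub_self, max_self, sub_zero, Finset.sum_const, Finset.card_univ,
    Fintype.card_fin, nsmul_eq_mul] at h
  refine h.trans (expect_mono fun ζ _ => ?_)
  obtain ⟨y, hy, hgain⟩ := exists_feasible_totalGain (hT := hT) ζ (c := fun _ => √(T : ℝ))
    fun _ => Real.sqrt_nonneg _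
  obtain ⟨x, hx⟩ := exists_isOptimal (a := fun t => (knapsack d T hT).item (ζ t))
    ⟨y, hy⟩
  have hx' : IsOptimal (fun t => (knapsack d T hT).item (ζ t)) (knapsack d T hT).capacity x := hx
  exact hgain.symm.trans_le ((hx.2 y hy).trans_eq hx'.optValue_eq.symm)

theorem knapsack_load_le {n : ℕ} {a : Fin (n + 1) → Item Unit (Fin d)} {c : Fin d → ℝ}
    {x : Fin (n + 1) → Option Unit} (hx : Feasible a c x)
    (ha : ∀ i k, 0 ≤ (a i).use () k) (k : Fin d) : (a 0).load (x 0) k ≤ c k := by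
  refine le_trans ?_ (hx k)
  refine Finset.single_le_sum (f := fun i => (a i).load (x i) k) (fun i _ => ?_)
    (Finset.mem_univ 0)
  rcases x i with _ | y
  · exact le_rfl
  · exact ha i k

theorem knapsack_use_nonneg (o : Option (Fin d)) (k : Fin d) :
    0 ≤ ((knapsack d T hT).item o).use () k :=
  knapsack_load_nonneg o (some ()) k

theorem knapsack_valueFrom_nonneg (forecast : (n : ℕ) → PMF (Fin n → Item Unit (Fin d)))
    (s : Solver Unit (Fin d)) (n : ℕ) (c : Fin d → ℝ) :
    0 ≤ (knapsack d T hT).valueFrom forecast s n c :=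
  le_expect fun _ _ => Finset.sum_nonneg fun _ _ => knapsack_gain_nonneg _ _

theorem knapsack_valueFrom_le (forecast : (n : ℕ) → PMF (Fin n → Item Unit (Fin d)))
    (s : Solver Unit (Fin d)) (n : ℕ) (c : Fin d → ℝ) :
    (knapsack d T hT).valueFrom forecast s n c ≤ n := by
  refine expect_le fun ω _ => (Finset.sum_le_sum fun t _ => knapsack_gain_le_one _ _).trans_eq ?_
  simp

end Knapsack

end OnlineAllocation
namespace OnlineAllocation

/-! ### OSO: the potential argument -/

section Oso

/-- The potential of a residual capacity `c` that falls short of the expected demand `n * p`. -/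
noncomputable def shortfall (p : ℝ) (n : ℕ) (c : ℝ) : ℝ :=
  max (n * p - c) 0 ^ 2 / (2 * (√(n * p) + 1))

/-- Here `q` is the probability that one unit of the resource is used. The expected potential drops
by enough to pay for the deficit term in the one-step gain, up to a noise term. -/
theorem shortfall_step {p : ℝ} (hp : 0 < p) (hp1 : p ≤ 1) (n : ℕ) {c q : ℝ}
    (hc0 : 0 ≤ c) (hq : q ≤ c / (n + 1)) :
    shortfall p n c + q * (shortfall p n (c - 1) - shortfall p n c) ≤
      shortfall p (n + 1) c - max ((n + 1) * p - c) 0 / (n + 1) +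
        (√((n + 1) * p) + 1) / (n + 1) := by
  set N : ℝ := n + 1 with hN
  have hn0 : (0 : ℝ) ≤ n := Nat.cast_nonneg n
  have hN0 : 0 < N := by positivity
  set μ : ℝ := √(n * p) + 1 with hμ
  set ν : ℝ := √(N * p) + 1 with hν
  have hμ1 : 1 ≤ μ := by linarith [Real.sqrt_nonneg (n * p)]
  have hν1 : 1 ≤ ν := by linarith [Real.sqrt_nonneg (N * p)]
  have hμ2 : (μ - 1) ^ 2 = n * p := by rw [hμ, add_sub_cancel_right, Real.sq_sqrt (by positivity)]
  have hν2 : (ν - 1) ^ 2 = N * p := by rw [hν, add_sub_cancel_right, Real.sq_sqrt (by positivity)]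
  have hμν : ν - 1 ≤ μ := by
    refine abs_le_of_sq_le_sq' ?_ (by linarith) |>.2
    nlinarith
  -- The `+ 1` in the denominators serves here: it gives `ν - 1 ≤ μ`, and keeps `μ` positive at `n =
  -- 0`.
  have hprod : N * p ≤ μ * ν := by nlinarith
  have hratio : n * ν ≤ N * μ := by
    have : n * (ν - 1) ≤ N * (μ - 1) := by
      refine abs_le_of_sq_le_sq' ?_ (mul_nonneg hN0.le (by linarith)) |>.2
      rw [mul_pow, mul_pow, hμ2, hν2]
      have : 0 ≤ N * n * p := by positivity
      nlinarith
    nlinarith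
  have hmono : shortfall p n c ≤ shortfall p n (c - 1) := by
    unfold shortfall
    gcongr
    linarith
  -- The potential decreases in the capacity, so the largest admissible `q` is the worst case.
  have hq' : shortfall p n c + q * (shortfall p n (c - 1) - shortfall p n c) ≤
      shortfall p n c + c / N * (shortfall p n (c - 1) - shortfall p n c) := by
    gcongr
  refine hq'.trans ?_
  have hcast : ((n + 1 : ℕ) : ℝ) = N := by push_cast; rfl
  unfold shortfall
  rw [hcast, ← hμ, ← hν]
  by_cases hc : c < N * p
  · set u := N * p - c with hu
    have hu0 : 0 < u := by linarith
    rw [max_eq_left hu0.le]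
    set e := c / N with he
    have he' : e = p - u / N := by
      rw [he, hu]
      field_simp
      ring
    have he0 : 0 ≤ e := by positivity
    have hep : e ≤ p := by
      have : 0 ≤ u / N := by positivity
      linarith
    have hA : max (n * p - c) 0 ^ 2 ≤ (u - p) ^ 2 := by
      rw [show n * p - c = u - p by rw [hu, hN]; ring]
      rcases max_cases (u - p) 0 with h | h <;> rw [h.1]
      rw [zero_pow two_ne_zero]
      positivity
    have hB : max (n * p - (c - 1)) 0 ^ 2 ≤ (u - p + 1) ^ 2 := by
      rw [show n * p - (c - 1) = u - p + 1 by rw [hu, hN]; ring]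
      rcases max_cases (u - p + 1) 0 with h | h <;> rw [h.1]
      rw [zero_pow two_ne_zero]
      positivity
    -- Squared mean plus variance: the new deficit has mean `u * (n / N)` and variance `e * (1 - e)
    -- ≤ p`.
    have hmean : (1 - e) * (u - p) ^ 2 + e * (u - p + 1) ^ 2 ≤ (u * (n / N)) ^ 2 + p := by
      have h1 : u * (n / N) = u - p + e := by
        rw [he', show (n : ℝ) = N - 1 by rw [hN]; ring]
        field_simp
        ring
      rw [h1]
      nlinarith
    -- One factor `n / N` pays for replacing `μ` by `ν`; the other is kept as the drift.
    have hdrift : (u * (n / N)) ^ 2 / (2 * μ) ≤ u ^ 2 * (n / N) / (2 * ν) := by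
      rw [div_le_div_iff₀ (by positivity) (by positivity)]
      have : (n / N) * ν ≤ μ := by
        rw [div_mul_eq_mul_div, div_le_iff₀ hN0]
        linarith
      calc (u * (n / N)) ^ 2 * (2 * ν) = 2 * (u ^ 2 * (n / N)) * ((n / N) * ν) := by ring
        _ ≤ 2 * (u ^ 2 * (n / N)) * μ := by gcongr
        _ = _ := by ring
    have hnoise : p / (2 * μ) ≤ ν / (2 * N) := by
      rw [div_le_div_iff₀ (by positivity) (by positivity)]
      linarith
    -- Completing the square trades the quadratic drift for the linear term `u / N`.
    have hsq : u ^ 2 / (2 * ν) - u / N + ν / N =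
        u ^ 2 * (n / N) / (2 * ν) + ν / (2 * N) + (u - ν) ^ 2 / (2 * ν * N) := by
      rw [show (n : ℝ) = N - 1 by rw [hN]; ring]
      field_simp
      ring
    have hsq0 : 0 ≤ (u - ν) ^ 2 / (2 * ν * N) := by positivity
    rw [hsq]
    calc _ = ((1 - e) * max (n * p - c) 0 ^ 2 + e * max (n * p - (c - 1)) 0 ^ 2) / (2 * μ) := by
          ring
      _ ≤ ((1 - e) * (u - p) ^ 2 + e * (u - p + 1) ^ 2) / (2 * μ) := by
          have : 0 ≤ 1 - e := by linarith
          gcongr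
      _ ≤ ((u * (n / N)) ^ 2 + p) / (2 * μ) := by gcongr
      _ = (u * (n / N)) ^ 2 / (2 * μ) + p / (2 * μ) := add_div _ _ _
      _ ≤ _ := by linarith
  · push Not at hc
    have h0 : max (n * p - c) 0 = 0 := max_eq_right (by nlinarith)
    rw [h0, max_eq_right (by linarith : N * p - c ≤ 0)]
    simp only [ne_eq, OfNat.ofNat_ne_zero, not_false_eq_true, zero_pow, zero_div, sub_zero,
      zero_add]
    -- Without a current deficit, one unit of consumption creates a deficit of at most `1`, and none
    -- at all if `c` exceeds `N * p + 1`.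
    by_cases hc1 : c ≤ N * p + 1
    · have hB : max (n * p - (c - 1)) 0 ^ 2 ≤ 1 :=
        pow_le_one₀ (le_max_right _ _) (max_le (by nlinarith) zero_le_one)
      calc c / N * (max (n * p - (c - 1)) 0 ^ 2 / (2 * μ)) ≤ c / N * (1 / (2 * μ)) := by gcongr
        _ = c / (2 * μ) / N := by ring
        _ ≤ ν / N := by
          gcongr
          rw [div_le_iff₀ (by positivity)]
          nlinarith
    · rw [max_eq_right (by nlinarith)]
      simp
      positivity

/-- A lower bound for the reward that OSO collects per resource. -/
noncomputable def osoRate (p : ℝ) (n : ℕ) : ℝ :=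
  n * p - 2 * ∑ m ∈ Finset.range n, (√((m + 1) * p) + 1) / (m + 1)

theorem sum_one_div_sqrt_le (n : ℕ) :
    ∑ m ∈ Finset.range n, 1 / √((m : ℝ) + 1) ≤ 2 * √(n : ℝ) := by
  induction n with
  | zero => simp
  | succ n ih =>
    rw [Finset.sum_range_succ]
    push_cast
    have h1 : 0 < √((n : ℝ) + 1) := by positivity
    have h2 : √((n : ℝ) + 1) ^ 2 = n + 1 := Real.sq_sqrt (by positivity)
    have h3 : √(n : ℝ) ^ 2 = n := Real.sq_sqrt (by positivity)
    have : 1 / √((n : ℝ) + 1) ≤ 2 * √((n : ℝ) + 1) - 2 * √(n : ℝ) := by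
      rw [div_le_iff₀ h1]
      nlinarith [sq_nonneg (√((n : ℝ) + 1) - √(n : ℝ))]
    linarith

theorem sum_one_div_le_log (n : ℕ) :
    ∑ m ∈ Finset.range n, 1 / ((m : ℝ) + 1) ≤ 1 + Real.log n := by
  have h := harmonic_le_one_add_log n
  rw [harmonic] at h
  push_cast at h
  simpa only [one_div] using h

/-- The summand splits into `√p / √(m + 1)` and `1 / (m + 1)`, whose sums are at most `2 * √(n * p)`
and `1 + log n`. -/
theorem le_osoRate {p : ℝ} (hp : 0 < p) (n : ℕ) :
    n * p - 4 * √(n * p) - 2 - 2 * Real.log n ≤ osoRate p n := by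
  have h : ∑ m ∈ Finset.range n, (√((m + 1) * p) + 1) / ((m : ℝ) + 1) =
      √p * ∑ m ∈ Finset.range n, 1 / √((m : ℝ) + 1) +
        ∑ m ∈ Finset.range n, 1 / ((m : ℝ) + 1) := by
    rw [Finset.mul_sum, ← Finset.sum_add_distrib]
    refine Finset.sum_congr rfl fun m _ => ?_
    have h0 : (0 : ℝ) < m + 1 := by positivity
    have h1 : 0 < √((m : ℝ) + 1) := by positivity
    rw [Real.sqrt_mul h0.le, add_div]
    congr 1
    nth_rewrite 2 [← Real.sq_sqrt h0.le]
    field_simp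
  rw [osoRate, h, Real.sqrt_mul (Nat.cast_nonneg n)]
  have h1 := mul_le_mul_of_nonneg_left (sum_one_div_sqrt_le n) (Real.sqrt_nonneg p)
  have h2 := sum_one_div_le_log n
  linarith

variable {d T : ℕ} {hT : d ^ 2 < T}

/-- The bound separates over resources, so each step needs only the marginal load of every resource,
not the joint law of the residual capacities. -/
theorem le_knapsack_valueFrom_oso {s : Solver Unit (Fin d)} (hs : s.IsExact)
    (hs' : s.IsEquivariant) (n : ℕ) {c : Fin d → ℝ} (hc : ∀ k, 0 ≤ c k) :
    ∑ k, (osoRate (1 / √(T : ℝ)) n - shortfall (1 / √(T : ℝ)) n (c k)) ≤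
      (knapsack d T hT).valueFrom
        (fun n => (iid (knapsack d T hT).law n).map fun ζ i => (knapsack d T hT).item (ζ i))
        s n c := by
  have hp0 : 0 < 1 / √(T : ℝ) := one_div_pos.2 (sqrt_horizon_pos hT)
  have hp1 : 1 / √(T : ℝ) ≤ 1 := by
    rw [div_le_one (sqrt_horizon_pos hT), Real.one_le_sqrt]
    exact_mod_cast (Nat.zero_le _).trans_lt hT
  set p := 1 / √(T : ℝ) with hp
  set P := knapsack d T hT with hP
  induction n generalizing c with
  | zero =>
    rw [Problem.valueFrom_zero]
    refine (Finset.sum_eq_zero fun k _ => ?_).le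
    simp [osoRate, shortfall, hc k]
  | succ n ih =>
    have hN0 : (0 : ℝ) < n + 1 := by positivity
    have hopt : ∀ ζ : Fin (n + 1) → Option (Fin d),
        ∀ x ∈ (s (n + 1) (fun i => P.item (ζ i)) c).support,
          IsOptimal (fun i => P.item (ζ i)) c x := fun ζ x hx =>
      hs _ _ _ ⟨_, feasible_none _ hc⟩ x hx
    let E (f : (Fin (n + 1) → Option (Fin d)) → (Fin (n + 1) → Option Unit) → ℝ) : ℝ :=
      expect (iid P.law (n + 1)) fun ζ => expect (s (n + 1) (fun i => P.item (ζ i)) c) (f ζ)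
    have hload : ∀ k, E (fun ζ x => (P.item (ζ 0)).load (x 0) k) ≤ c k / (n + 1) := by
      intro k
      rw [le_div_iff₀ hN0, mul_comm]
      refine (expect_solver_first hs' P.law P.item n c fun a y => a.load y k).trans_le ?_
      exact expect_le fun ζ _ => expect_le fun x hx => (hopt ζ x hx).1 k
    have hgain : (∑ k, ((n + 1) * p - √((n + 1) * p) - max ((n + 1) * p - c k) 0 - 1)) / (n + 1) ≤
        E (fun ζ x => (P.item (ζ 0)).gain (x 0)) := by
      rw [div_le_iff₀ hN0, mul_comm (E _)]
      refine le_trans ?_ (expect_solver_first hs' P.law P.item n c fun a y => a.gain y).ge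
      have h := le_expect_sum_min_count (hT := hT) n.succ_pos c
      rw [← hp] at h
      push_cast at h
      refine h.trans (expect_mono fun ζ _ => le_expect fun x hx => ?_)
      obtain ⟨y, hy, hy'⟩ := exists_feasible_totalGain (hT := hT) ζ hc
      rw [← hy']
      exact (hopt ζ x hx).2 y hy
    -- The deficit term cancels. The noise `(√((n + 1) * p) + 1) / (n + 1)` enters twice, from the
    -- gain and from the potential: hence the `2` in `osoRate`.
    have hstep : ∀ k, osoRate p (n + 1) - shortfall p (n + 1) (c k) ≤
        ((n + 1) * p - √((n + 1) * p) - max ((n + 1) * p - c k) 0 - 1) / (n + 1) +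
          (osoRate p n - (shortfall p n (c k) + E (fun ζ x => (P.item (ζ 0)).load (x 0) k) *
            (shortfall p n (c k - 1) - shortfall p n (c k)))) := by
      intro k
      have h := shortfall_step hp0 hp1 n (hc k) (hload k)
      have h2 : osoRate p (n + 1) =
          osoRate p n + p - 2 * ((√((n + 1) * p) + 1) / (n + 1)) := by
        simp only [osoRate, Finset.sum_range_succ]
        push_cast
        ring
      have h3 : ((n + 1) * p - √((n + 1) * p) - max ((n + 1) * p - c k) 0 - 1) / (n + 1) =
          p - max ((n + 1) * p - c k) 0 / (n + 1) - (√((n + 1) * p) + 1) / (n + 1) := by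
        field_simp
        ring
      rw [h2, h3]
      linarith
    rw [hP, Problem.valueFrom_oso_succ, ← hP]
    calc _ ≤ ∑ k, _ := Finset.sum_le_sum fun k _ => hstep k
      _ ≤ E (fun ζ x => (P.item (ζ 0)).gain (x 0)) + ∑ k, (osoRate p n - (shortfall p n (c k) +
            E (fun ζ x => (P.item (ζ 0)).load (x 0) k) *
              (shortfall p n (c k - 1) - shortfall p n (c k)))) := by
        rw [Finset.sum_add_distrib, ← Finset.sum_div]
        gcongr
      _ = E fun ζ x => (P.item (ζ 0)).gain (x 0) + ∑ k, (osoRate p n - (shortfall p n (c k) +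
            (shortfall p n (c k - 1) - shortfall p n (c k)) *
              (P.item (ζ 0)).load (x 0) k)) := by
        simp only [E, expect_add, expect_sum, expect_sub, expect_const, expect_const_mul]
        simp only [mul_comm]
      _ ≤ _ := by
        refine expect_mono fun ζ _ => expect_mono fun x hx => ?_
        have hle := knapsack_load_le (hopt ζ x hx).1 fun i k => knapsack_use_nonneg (ζ i) k
        refine add_le_add le_rfl (le_trans (Finset.sum_le_sum fun k _ => ?_)
          (ih (c := fun k => c k - (P.item (ζ 0)).load (x 0) k) fun k => sub_nonneg.2 (hle k)))
        -- Loads are `0` or `1`, so the potential after the step is affine in the load, with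
        -- equality in both cases.
        rcases knapsack_load_eq (hT := hT) (ζ 0) (x 0) k with h | h <;> rw [← hP] at h <;>
          simp [h]

theorem le_knapsack_osoValue {s : Solver Unit (Fin d)} (hs : s.IsExact)
    (hs' : s.IsEquivariant) :
    d * (√(T : ℝ) - 4 * √√(T : ℝ) - 2 - 2 * Real.log T) ≤ (knapsack d T hT).osoValue s := by
  have hp0 : 0 < 1 / √(T : ℝ) := one_div_pos.2 (sqrt_horizon_pos hT)
  have hTp : T * (1 / √(T : ℝ)) = √(T : ℝ) := by
    rw [mul_one_div, Real.div_sqrt]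
  have h := le_knapsack_valueFrom_oso (hT := hT) hs hs' T (c := fun _ => √(T : ℝ))
    fun _ => Real.sqrt_nonneg _
  refine le_trans ?_ h
  have h1 := le_osoRate hp0 T
  rw [hTp] at h1
  have h0 : shortfall (1 / √(T : ℝ)) T √(T : ℝ) = 0 := by
    rw [shortfall, hTp, sub_self, max_self, zero_pow two_ne_zero, zero_div]
  simp only [h0, sub_zero, Finset.sum_const, Finset.card_univ, Fintype.card_fin, nsmul_eq_mul]
  gcongr

/-- The competitive ratio of OSO. -/
theorem competitive_knapsack_osoValue (hd : 2 < d) {s : Solver Unit (Fin d)} (hs : s.IsExact)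
    (hs' : s.IsEquivariant) :
    (1 - 8 * √(Real.log (d * T) / √(T : ℝ))) * (knapsack d T hT).optExpected ≤
      (knapsack d T hT).osoValue s := by
  set B := √(T : ℝ) with hB
  set L := Real.log (d * T) with hL
  have hB0 : 0 < B := sqrt_horizon_pos hT
  have hd' : (3 : ℝ) ≤ d := by exact_mod_cast hd
  have hBd : (d : ℝ) < B := lt_sqrt_horizon hT
  have hT0 : (1 : ℝ) ≤ T := by exact_mod_cast (Nat.zero_le _).trans_lt hT
  have hlogT : 0 ≤ Real.log T := Real.log_nonneg hT0
  have hLT : 1 + Real.log T ≤ L := by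
    rw [hL, Real.log_mul (by positivity) (by positivity)]
    have : 1 ≤ Real.log d := by
      rw [Real.le_log_iff_exp_le (by positivity)]
      linarith [Real.exp_one_lt_d9]
    linarith
  have hTB : Real.log T ≤ B := by
    have h1 : Real.log T = 2 * Real.log B := by
      rw [hB, Real.log_sqrt (by positivity)]
      ring
    have h2 : B / Real.exp 1 ≤ B / 2 := by
      gcongr
      linarith [Real.exp_one_gt_d9]
    have h3 : Real.log B ≤ B / Real.exp 1 := by
      have := Real.log_le_sub_one_of_pos (x := B / Real.exp 1) (by positivity)
      rw [Real.log_div (by positivity) (by positivity), Real.log_exp] at this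
      linarith
    linarith
  have hL0 : 0 < L := by linarith
  have hprod : √(L / B) * B = √(L * B) := by
    rw [show L * B = L / B * B ^ 2 by field_simp, Real.sqrt_mul (by positivity),
      Real.sqrt_sq hB0.le]
  -- The loss `4 * √B + 2 + 2 * log T` is at most `4 + 2 + 2 = 8` times `√(L * B)`.
  have h1 : √B ≤ √(L * B) := Real.sqrt_le_sqrt (by nlinarith)
  have h2 : Real.log T ≤ √(L * B) := Real.le_sqrt_of_sq_le (by nlinarith)
  have h3 : 1 ≤ √(L * B) := Real.one_le_sqrt.2 (by nlinarith)
  rcases le_total (1 - 8 * √(L / B)) 0 with hneg | hpos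
  · exact (mul_nonpos_of_nonpos_of_nonneg hneg knapsack_optExpected_nonneg).trans
      (knapsack_valueFrom_nonneg _ _ _ _)
  · calc _ ≤ (1 - 8 * √(L / B)) * (d * B) := by
          gcongr
          exact knapsack_optExpected_le (by omega)
      _ = d * (B - 8 * (√(L / B) * B)) := by ring
      _ ≤ d * (B - 4 * √B - 2 - 2 * Real.log T) := by
          rw [hprod]
          exact mul_le_mul_of_nonneg_left (by linarith) (by positivity)
      _ ≤ _ := le_knapsack_osoValue hs hs'

end Oso

end OnlineAllocation
namespace OnlineAllocation

/-! ### CE: capacity is saved for mean items -/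

section CertaintyEquivalent

variable {d T : ℕ} {hT : d ^ 2 < T}

/-- The expected consumption of every resource by an item of the knapsack. -/
noncomputable def meanUse (d T : ℕ) : ℝ :=
  1 - (d - 1) / √(T : ℝ)

theorem meanUse_pos (hT : d ^ 2 < T) : 0 < meanUse d T := by
  rw [meanUse, sub_pos, div_lt_one (sqrt_horizon_pos hT)]
  linarith [lt_sqrt_horizon hT]

theorem meanUse_mul (hT : d ^ 2 < T) : √(T : ℝ) * meanUse d T = √(T : ℝ) - (d - 1) := by
  have := (sqrt_horizon_pos hT).ne'
  rw [meanUse]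
  field_simp

theorem meanUse_lt_one (hT : d ^ 2 < T) (hd : 1 < d) : meanUse d T < 1 := by
  have : (1 : ℝ) < d := by exact_mod_cast hd
  have : 0 < (d - 1) / √(T : ℝ) := div_pos (by linarith) (sqrt_horizon_pos hT)
  rw [meanUse]
  linarith

theorem knapsack_meanItem_reward (u : Unit) : (knapsack d T hT).meanItem.reward u = 1 := by
  simp [Problem.meanItem, knapsack, expect_const]

theorem knapsack_meanItem_use (u : Unit) (k : Fin d) :
    (knapsack d T hT).meanItem.use u k = meanUse d T := by
  simp only [Problem.meanItem, knapsack, expect_scenarioLaw, meanUse]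
  rw [← Finset.mul_sum]
  simp
  ring

/-- The number of accepted forecast items. -/
def accepted {n : ℕ} (y : Fin (n + 1) → Option Unit) : ℕ :=
  (Finset.univ.filter fun i : Fin n => y i.succ ≠ none).card

theorem ce_totalGain {n : ℕ} (o : Option (Fin d)) (y : Fin (n + 1) → Option Unit) :
    totalGain (Fin.cons ((knapsack d T hT).item o) fun _ => (knapsack d T hT).meanItem) y =
      ((knapsack d T hT).item o).gain (y 0) + accepted y := by
  rw [totalGain, Fin.sum_univ_succ]
  simp only [Fin.cons_zero, Fin.cons_succ, accepted]
  rw [← Finset.sum_boole]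
  congr 1
  refine Finset.sum_congr rfl fun i _ => ?_
  rcases h : y i.succ with _ | u
  · simp [Item.gain]
  · simp [Item.gain, knapsack_meanItem_reward]

theorem ce_feasible_iff {n : ℕ} (o : Option (Fin d)) (c : Fin d → ℝ)
    (y : Fin (n + 1) → Option Unit) :
    Feasible (Fin.cons ((knapsack d T hT).item o) fun _ => (knapsack d T hT).meanItem) c y ↔
      ∀ k, ((knapsack d T hT).item o).load (y 0) k + accepted y * meanUse d T ≤ c k := by
  refine forall_congr' fun k => ?_
  rw [Fin.sum_univ_succ]
  simp only [Fin.cons_zero, Fin.cons_succ, accepted]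
  rw [← Finset.sum_boole, Finset.sum_mul]
  have : ∀ i : Fin n, (knapsack d T hT).meanItem.load (y i.succ) k =
      (if y i.succ ≠ none then 1 else 0) * meanUse d T := by
    intro i
    rcases h : y i.succ with _ | u
    · simp [Item.load]
    · simp [Item.load, knapsack_meanItem_use]
  simp only [this]

/-- Rejecting the current item and accepting `m` forecast items. -/
theorem exists_reject_accepted {n m : ℕ} (hm : m ≤ n) :
    ∃ y : Fin (n + 1) → Option Unit, y 0 = none ∧ accepted y = m := by
  obtain ⟨S, -, hS⟩ := Finset.exists_subset_card_eq
    (s := (Finset.univ : Finset (Fin n))) (n := m) (by simpa using hm)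
  refine ⟨Fin.cons none fun i => if i ∈ S then some () else none, rfl, ?_⟩
  simp [accepted, hS]

/-- Rejections leave the capacities unchanged, and in the last period an exact solver accepts an
item that fits. -/
theorem one_le_knapsack_ce {s : Solver Unit (Fin d)} (hs : s.IsExact) (n : ℕ) {c : Fin d → ℝ}
    (hc : ∀ k, 1 ≤ c k) :
    1 ≤ (knapsack d T hT).valueFrom (fun _ => PMF.pure fun _ => (knapsack d T hT).meanItem)
      s (n + 1) c := by
  induction n with
  | zero =>
    rw [Problem.valueFrom_ce_succ]
    refine le_expect fun o _ => le_expect fun x hx => ?_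
    have hopt := hs _ _ _ ⟨_, feasible_none _ fun k => zero_le_one.trans (hc k)⟩ x hx
    rw [Problem.valueFrom_zero, add_zero]
    have h := hopt.2 (fun _ => some ()) <| (ce_feasible_iff o c _).2 fun k => by
      have := hc k
      simp only [accepted, Finset.univ_eq_empty, Finset.filter_empty, Finset.card_empty]
      rcases knapsack_load_eq (hT := hT) o (some ()) k with h | h <;> rw [h] <;>
        push_cast <;> linarith
    rw [ce_totalGain, ce_totalGain] at h
    simpa [accepted, show ((knapsack d T hT).item o).gain (some ()) = 1 from rfl] using h
  | succ n ih =>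
    rw [Problem.valueFrom_ce_succ]
    refine le_expect fun o _ => le_expect fun x _ => ?_
    rcases x 0 with _ | u
    · simpa [Item.gain, Item.load] using ih
    · have h : ((knapsack d T hT).item o).gain (some u) = 1 := rfl
      rw [h]
      linarith [knapsack_valueFrom_nonneg (hT := hT)
        (fun _ => PMF.pure fun _ => (knapsack d T hT).meanItem) s (n + 1)
          fun k => c k - ((knapsack d T hT).item o).load (some u) k]

/-- If all residual capacities exceed the use of `B` mean items by integers, then the
certainty-equivalent heuristic only uses that excess before the last `B` periods. -/
theorem knapsack_ce_le_of_excess (hd : 1 < d) (B : ℕ)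
    {s : Solver Unit (Fin d)} (hs : s.IsExact) (n : ℕ) (e : Fin d → ℕ) :
    (knapsack d T hT).valueFrom (fun _ => PMF.pure fun _ => (knapsack d T hT).meanItem) s n
      (fun k => B * meanUse d T + e k) ≤ ∑ k, (e k : ℝ) + B := by
  have hμ := meanUse_pos hT
  have hμ1 := meanUse_lt_one hT hd
  induction n generalizing e with
  | zero =>
    rw [Problem.valueFrom_zero]
    positivity
  | succ n ih =>
    rcases lt_or_ge n B with hn | hn
    · have h1 : ((n + 1 : ℕ) : ℝ) ≤ B := by exact_mod_cast hn
      have h2 : (0 : ℝ) ≤ ∑ k, (e k : ℝ) := by positivity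
      linarith [knapsack_valueFrom_le (hT := hT)
        (fun _ => PMF.pure fun _ => (knapsack d T hT).meanItem) s (n + 1)
          fun k => B * meanUse d T + e k]
    rw [Problem.valueFrom_ce_succ]
    refine expect_le fun o _ => expect_le fun x hx => ?_
    have hopt := hs _ _ _ ⟨_, feasible_none _ fun k => by positivity⟩ x hx
    -- Using a resource without excess costs a full unit, more than one mean item. At most `B - 2`
    -- mean items would remain, so the total would fall below the `B` obtained by rejecting.
    have hle : ∀ k, ((knapsack d T hT).item o).load (x 0) k ≤ e k := by
      intro k
      rcases knapsack_load_eq (hT := hT) o (x 0) k with h | h <;> rw [h]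
      · positivity
      by_contra hlt
      push Not at hlt
      have he : e k = 0 := by
        have : e k < 1 := by exact_mod_cast hlt
        omega
      obtain ⟨y, hy0, hy⟩ := exists_reject_accepted hn
      have hyf := (ce_feasible_iff (hT := hT) o (fun k => B * meanUse d T + e k) y).2 fun k => by
        rw [hy0, hy]
        simp [Item.load]
      have hval := hopt.2 y hyf
      rw [ce_totalGain, ce_totalGain, hy0, hy] at hval
      have hg := knapsack_gain_le_one (hT := hT) o (x 0)
      have hg0 : ((knapsack d T hT).item o).gain none = 0 := rfl
      have hcap := (ce_feasible_iff o _ x).1 hopt.1 k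
      rw [h, he] at hcap
      push_cast at hcap
      have : (B - 1 : ℝ) * meanUse d T ≤ accepted x * meanUse d T := by
        gcongr
        linarith
      linarith
    have hload : ∃ l : Fin d → ℕ, ∀ k, ((knapsack d T hT).item o).load (x 0) k = l k := by
      have (k : Fin d) : ∃ m : ℕ, ((knapsack d T hT).item o).load (x 0) k = m := by
        rcases knapsack_load_eq (hT := hT) o (x 0) k with h | h
        exacts [⟨0, by simp [h]⟩, ⟨1, by simp [h]⟩]
      exact Classical.skolem.1 this
    obtain ⟨l, hl⟩ := hload
    have hle' : ∀ k, l k ≤ e k := fun k => by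
      have := hle k
      rw [hl] at this
      exact_mod_cast this
    -- Every acceptance consumes at least one unit of the total excess, which pays for its gain.
    have h1 := ih fun k => e k - l k
    have h2 := knapsack_gain_le_load (hT := hT) (by omega) o (x 0)
    simp only [Nat.cast_sub (hle' _), Finset.sum_sub_distrib] at h1
    simp only [hl] at h2 ⊢
    simp only [← add_sub_assoc] at h1
    linarith

/-- A certainty-equivalent heuristic that prefers rejection accepts nothing while the forecast
items alone can exhaust the capacity. -/
theorem knapsack_ce_le_of_prefersRejection (hd : 1 < d) {s : Solver Unit (Fin d)}
    (hs : s.PrefersRejection) (n : ℕ) :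
    (knapsack d T hT).valueFrom (fun _ => PMF.pure fun _ => (knapsack d T hT).meanItem) s n
      (fun _ => √(T : ℝ)) ≤ √(T : ℝ) / meanUse d T := by
  have hμ := meanUse_pos hT
  have hμ1 := meanUse_lt_one hT hd
  induction n with
  | zero =>
    rw [Problem.valueFrom_zero]
    positivity
  | succ n ih =>
    rcases lt_or_ge n ⌊√(T : ℝ) / meanUse d T⌋₊ with hn | hn
    · refine (knapsack_valueFrom_le _ _ _ _).trans (le_trans ?_ (Nat.floor_le (by positivity)))
      exact_mod_cast hn
    rw [Problem.valueFrom_ce_succ]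
    refine expect_le fun o _ => expect_le fun x hx => ?_
    have hx0 : x 0 = none := by
      refine hs n _ _ ?_ x hx
      obtain ⟨y, hy0, hy⟩ := exists_reject_accepted hn
      refine ⟨y, ⟨(ce_feasible_iff o _ y).2 fun k => ?_, fun z hz => ?_⟩, hy0⟩
      · rw [hy0, hy]
        have := (le_div_iff₀ hμ).1 (Nat.floor_le (a := √(T : ℝ) / meanUse d T) (by positivity))
        simpa [Item.load] using this
      · have hzf := (ce_feasible_iff o _ z).1 hz
        -- On some resource the current item uses at least its gain, hence no less than a mean item
        -- would; so no solution beats filling the capacity with mean items.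
        obtain ⟨k, hk⟩ : ∃ k, ((knapsack d T hT).item o).gain (z 0) ≤
            ((knapsack d T hT).item o).load (z 0) k := by
          rcases z 0 with _ | u
          · exact ⟨⟨0, by omega⟩, le_rfl⟩
          · rcases o with _ | l
            · exact ⟨⟨0, by omega⟩, le_rfl⟩
            · exact ⟨l, by simp [Item.gain, Item.load, knapsack]⟩
        obtain ⟨m, hm⟩ : ∃ m : ℕ, ((knapsack d T hT).item o).gain (z 0) = m := by
          rcases z 0 with _ | u
          exacts [⟨0, by simp [Item.gain]⟩, ⟨1, by simp [Item.gain, knapsack]⟩]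
        have hg0 : ((knapsack d T hT).item o).gain none = 0 := rfl
        rw [ce_totalGain, ce_totalGain, hy0, hy, hg0, zero_add, hm]
        have : m + accepted z ≤ ⌊√(T : ℝ) / meanUse d T⌋₊ := by
          rw [Nat.le_floor_iff (by positivity), le_div_iff₀ hμ]
          push_cast
          rw [← hm]
          have h1 := hzf k
          have h2 : ((knapsack d T hT).item o).gain (z 0) * meanUse d T ≤
              ((knapsack d T hT).item o).gain (z 0) :=
            mul_le_of_le_one_right (knapsack_gain_nonneg _ _) hμ1.le
          linarith
        exact_mod_cast this
    rw [hx0]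
    simpa [Item.gain, Item.load] using ih

theorem knapsack_ceValue_le (hd : 1 < d) {s : Solver Unit (Fin d)} (hs : s.IsExact)
    (h : IsSquare T ∨ s.PrefersRejection) :
    (knapsack d T hT).ceValue s ≤ √(T : ℝ) + d * (d - 1) := by
  have hB := meanUse_mul hT
  have hB0 := sqrt_horizon_pos hT
  have hd1 : (1 : ℝ) < d := by exact_mod_cast hd
  rcases h with ⟨B, rfl⟩ | h
  · have hBs : √((B * B : ℕ) : ℝ) = B := by
      push_cast
      exact Real.sqrt_mul_self (Nat.cast_nonneg B)
    -- For `√T = B`, `meanUse_mul` gives `B = B * meanUse + (d - 1)`: the excess is an integer.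
    have h1 := knapsack_ce_le_of_excess (hT := hT) hd B hs (B * B) fun _ => d - 1
    have h2 : (fun _ : Fin d => (B : ℝ) * meanUse d (B * B) + (d - 1 : ℕ)) =
        fun _ => √((B * B : ℕ) : ℝ) := by
      funext k
      rw [hBs] at hB ⊢
      rw [hB, Nat.cast_sub hd.le]
      push_cast
      ring
    rw [h2] at h1
    refine h1.trans_eq ?_
    rw [hBs, Finset.sum_const, Finset.card_univ, Fintype.card_fin, nsmul_eq_mul,
      Nat.cast_sub hd.le]
    push_cast
    ring
  · refine (knapsack_ce_le_of_prefersRejection (hT := hT) hd h T).trans ?_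
    rw [div_le_iff₀ (meanUse_pos hT), add_mul, hB]
    -- Since `√T / meanUse = √T + (d - 1) / meanUse`, this yields the same bound as for squares.
    have h1 : 1 ≤ d * meanUse d T := by
      have h2 := lt_sqrt_horizon hT
      have h3 : √(T : ℝ) * 1 ≤ √(T : ℝ) * (d * meanUse d T) := by
        rw [mul_left_comm, hB]
        nlinarith
      exact le_of_mul_le_mul_left h3 hB0
    nlinarith

theorem knapsack_ceValue_pos {s : Solver Unit (Fin d)} (hs : s.IsExact) :
    0 < (knapsack d T hT).ceValue s := by
  obtain ⟨n, rfl⟩ := Nat.exists_eq_succ_of_ne_zero (Nat.ne_zero_of_lt hT)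
  refine zero_lt_one.trans_le (one_le_knapsack_ce hs n fun _ => ?_)
  exact Real.one_le_sqrt.2 (by simp)

end CertaintyEquivalent

/-! ### Asymptotics in `T` and the final comparisons -/

theorem exists_forall_lt_mul_sqrt {δ : ℝ} (hδ : 0 < δ) (a b : ℝ) :
    ∃ T₀ : ℕ, ∀ T : ℕ, T₀ ≤ T → a * √√(T : ℝ) + b < δ * √(T : ℝ) := by
  have h : Filter.Tendsto (fun T : ℕ => √√(T : ℝ)) Filter.atTop Filter.atTop :=
    Real.tendsto_sqrt_atTop.comp (Real.tendsto_sqrt_atTop.comp tendsto_natCast_atTop_atTop)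
  refine Filter.eventually_atTop.1 ?_
  filter_upwards [h.eventually_ge_atTop 1, h.eventually_gt_atTop ((|a| + |b|) / δ)] with T h1 h2
  rw [div_lt_iff₀ hδ] at h2
  nth_rewrite 2 [← Real.sq_sqrt (Real.sqrt_nonneg (T : ℝ))]
  nlinarith [le_abs_self a, le_abs_self b, abs_nonneg a, abs_nonneg b]

theorem log_le_sqrt_sqrt {x : ℝ} (hx : 0 < x) : Real.log x ≤ 4 * √√x := by
  have h := Real.log_le_sub_one_of_pos (Real.sqrt_pos.2 (Real.sqrt_pos.2 hx))
  rw [Real.log_sqrt (Real.sqrt_nonneg x), Real.log_sqrt hx.le] at h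
  linarith

theorem exists_forall_mul_ceValue_le_osoValue {d : ℕ} (hd : 1 < d) {M : ℝ} (hM : M < d) :
    ∃ T₀ : ℕ, ∀ (T : ℕ) (hT : d ^ 2 < T), T₀ ≤ T → ∀ s s' : Solver Unit (Fin d),
      s.IsExact → s.IsEquivariant → s'.IsExact → (IsSquare T ∨ s'.PrefersRejection) →
        M * (knapsack d T hT).ceValue s' ≤ (knapsack d T hT).osoValue s := by
  have hd0 : (0 : ℝ) < d := by exact_mod_cast zero_lt_one.trans hd
  -- `12 = 4 + 2 * 4`, the logarithm being absorbed by `log_le_sqrt_sqrt`; `max M 0` covers negative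
  -- `M`.
  obtain ⟨T₀, h⟩ := exists_forall_lt_mul_sqrt (sub_pos.2 (max_lt hM hd0)) (d * 12)
    (max M 0 * (d * (d - 1)) + d * 2)
  refine ⟨T₀, fun T hT hT₀ s s' hs hse hs' hs'' => ?_⟩
  have h1 := h T hT₀
  have hlog := log_le_sqrt_sqrt (x := T) (by exact_mod_cast (Nat.zero_le _).trans_lt hT)
  calc M * (knapsack d T hT).ceValue s' ≤ max M 0 * (√(T : ℝ) + d * (d - 1)) :=
        mul_le_mul (le_max_left _ _) (knapsack_ceValue_le hd hs' hs'')
          (knapsack_ceValue_pos hs').le (le_max_right _ _)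
    _ ≤ d * (√(T : ℝ) - 4 * √√(T : ℝ) - 2 - 2 * Real.log T) := by nlinarith
    _ ≤ _ := le_knapsack_osoValue hs hse

theorem exists_forall_ceValue_lt_optExpected {d : ℕ} (hd : 1 < d) {ρ : ℝ} (hρ : 1 / (d : ℝ) < ρ)
    (α : ℝ) :
    ∃ T₀ : ℕ, ∀ (T : ℕ) (hT : d ^ 2 < T), T₀ ≤ T → ∀ s : Solver Unit (Fin d),
      s.IsExact → (IsSquare T ∨ s.PrefersRejection) →
        (knapsack d T hT).ceValue s < ρ * (knapsack d T hT).optExpected - α := by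
  have hd0 : (0 : ℝ) < d := by exact_mod_cast zero_lt_one.trans hd
  have hρ0 : 0 < ρ := (one_div_pos.2 hd0).trans hρ
  have hρd : 0 < ρ * d - 1 := by
    rw [div_lt_iff₀ hd0] at hρ
    linarith
  obtain ⟨T₀, h⟩ := exists_forall_lt_mul_sqrt hρd (ρ * d) (ρ * d + α + d * (d - 1))
  refine ⟨T₀, fun T hT hT₀ s hs hs' => ?_⟩
  have h1 := h T hT₀
  have h2 := mul_le_mul_of_nonneg_left (le_knapsack_optExpected (hT := hT)) hρ0.le
  have h3 := knapsack_ceValue_le (hT := hT) hd hs hs'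
  linarith

/-- The ratio with constant `8` needs only `64 * log (d * T) / ε ^ 2 ≤ √T`, which the threshold
exceeds. -/
theorem competitive_knapsack_osoValue_of_le {d T : ℕ} {hT : d ^ 2 < T} (hd : 2 < d) {ε : ℝ}
    (hε : 0 < ε) (hε1 : ε ≤ 0.001)
    (h : 1024 * Real.log (2 * d * T / ε) * (Real.log (1 / ε) ^ 3 / ε ^ 2) ≤ √(T : ℝ))
    {s : Solver Unit (Fin d)} (hs : s.IsExact) (hs' : s.IsEquivariant) :
    (1 - ε) * (knapsack d T hT).optExpected ≤ (knapsack d T hT).osoValue s := by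
  refine le_trans ?_ (competitive_knapsack_osoValue hd hs hs')
  have hB0 := sqrt_horizon_pos hT
  have hd' : (1 : ℝ) ≤ d := by exact_mod_cast (by omega : 1 ≤ d)
  have hT0 : (1 : ℝ) ≤ T := by exact_mod_cast (Nat.zero_le _).trans_lt hT
  have hopt := knapsack_optExpected_nonneg (hT := hT)
  have hdT : (1 : ℝ) ≤ d * T := by nlinarith
  have hlog0 : 0 ≤ Real.log (d * T) := Real.log_nonneg hdT
  have hlog : Real.log (d * T) ≤ Real.log (2 * d * T / ε) := by
    refine Real.log_le_log (by positivity) ?_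
    rw [le_div_iff₀ hε]
    nlinarith
  have hlog1 : 1 ≤ Real.log (1 / ε) := by
    rw [Real.le_log_iff_exp_le (by positivity), le_div_iff₀ hε]
    nlinarith [Real.exp_one_lt_d9]
  have hlog3 : 1 ≤ Real.log (1 / ε) ^ 3 := one_le_pow₀ hlog1
  have h1 : 64 * (Real.log (d * T) / ε ^ 2) ≤ √(T : ℝ) :=
    calc 64 * (Real.log (d * T) / ε ^ 2) = 64 * Real.log (d * T) * (1 / ε ^ 2) := by ring
      _ ≤ 1024 * Real.log (2 * d * T / ε) * (Real.log (1 / ε) ^ 3 / ε ^ 2) := by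
        have := hlog0.trans hlog
        gcongr
        norm_num
      _ ≤ _ := h
  have h2 : √(Real.log (d * T) / √(T : ℝ)) ≤ ε / 8 := by
    rw [Real.sqrt_le_left (by positivity), div_le_iff₀ hB0]
    rw [← mul_div_assoc, div_le_iff₀ (by positivity)] at h1
    linarith
  gcongr
  linarith

end OnlineAllocation

theorem proposition2 :
    -- OSO beats CE by any factor `M < d` for all large `T`, hence by arbitrarily large factors
    (∀ d : ℕ, 2 < d → ∀ M : ℝ, M < d → ∃ T₀ : ℕ,
      ∀ (T : ℕ) (hT : d ^ 2 < T), T₀ ≤ T → ∀ s s' : OnlineAllocation.Solver Unit (Fin d),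
        s.IsExact → s.IsEquivariant → s'.IsExact → (IsSquare T ∨ s'.PrefersRejection) →
          0 < (OnlineAllocation.knapsack d T hT).ceValue s' ∧
          M * (OnlineAllocation.knapsack d T hT).ceValue s' ≤
            (OnlineAllocation.knapsack d T hT).osoValue s) ∧
    -- the competitive ratio of CE is at most `1 / d`
    (∀ d : ℕ, 2 < d → ∀ ρ : ℝ, 1 / (d : ℝ) < ρ → ∀ α : ℝ, ∃ T₀ : ℕ,
      ∀ (T : ℕ) (hT : d ^ 2 < T), T₀ ≤ T → ∀ s : OnlineAllocation.Solver Unit (Fin d),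
        s.IsExact → (IsSquare T ∨ s.PrefersRejection) →
          (OnlineAllocation.knapsack d T hT).ceValue s <
            ρ * (OnlineAllocation.knapsack d T hT).optExpected - α) ∧
    -- OSO achieves `1 - ε` as soon as the capacity exceeds a threshold
    (∀ (d T : ℕ) (hT : d ^ 2 < T), 2 < d → ∀ ε : ℝ, 0 < ε → ε ≤ 0.001 →
      1024 * Real.log (2 * d * T / ε) * (Real.log (1 / ε) ^ 3 / ε ^ 2) ≤ √(T : ℝ) →
      ∀ s : OnlineAllocation.Solver Unit (Fin d), s.IsExact → s.IsEquivariant →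
        (1 - ε) * (OnlineAllocation.knapsack d T hT).optExpected ≤
          (OnlineAllocation.knapsack d T hT).osoValue s) ∧
    -- OSO achieves `1 - O(√(log (d T) / B))` with `B = √T`
    (∃ C : ℝ, 0 < C ∧ ∀ (d T : ℕ) (hT : d ^ 2 < T), 2 < d →
      ∀ s : OnlineAllocation.Solver Unit (Fin d), s.IsExact → s.IsEquivariant →
        (1 - C * √(Real.log (d * T) / √(T : ℝ))) *
            (OnlineAllocation.knapsack d T hT).optExpected ≤
          (OnlineAllocation.knapsack d T hT).osoValue s) := by
  refine ⟨fun d hd M hM => ?_, fun d hd ρ hρ α =>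
    OnlineAllocation.exists_forall_ceValue_lt_optExpected (by omega) hρ α,
    fun d T hT hd ε hε hε1 h s hs hs' =>
      OnlineAllocation.competitive_knapsack_osoValue_of_le hd hε hε1 h hs hs',
    8, by norm_num, fun d T hT hd s hs hs' =>
      OnlineAllocation.competitive_knapsack_osoValue hd hs hs'⟩
  obtain ⟨T₀, h⟩ :=
    OnlineAllocation.exists_forall_mul_ceValue_le_osoValue (d := d) (by omega) hM
  exact ⟨T₀, fun T hT hT₀ s s' hs hse hs' hs'' =>
    ⟨OnlineAllocation.knapsack_ceValue_pos hs', h T hT hT₀ s s' hs hse hs' hs''⟩⟩
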